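/- **Setting.** Let $G=(V,E)$ be a finite undirected graph whose vertices are users, with neighbourhoods $N(v)$ and closed neighbourhoods $N[v]=N(v)\cup\{v\}$. A *packing* of $G$ is a set $U\subseteq V$ such that $N[u]\cap N[u']=\emptyset$ for all distinct $u,u'\in U$; the *packing number* $\rho(G)$ is the largest size of a packing. Every user $v$ has an input $x_v\in\{0,\dots,\Delta\}$, where $\Delta\ge 0$ is an integer. In an interactive *protocol* the users hold independent private coins and exchange private messages in finitely many synchronous rounds; each message is a (measurable) function of the sender's input, the sender's coins and the messages that the sender has received so far. The *view* of a user consists of its input and of all messages that it received and sent, with their sources and destinations; the view of a set of users is the tuple of their views. The protocol is $(\varepsilon,G)$-*TGDP* if for every $v\in V$, all input vectors $\mathbf x,\mathbf x'$ that differ at most in the coordinate $v$, and every measurable set $S$ of views of $V\setminus N[v]$, $$\Pr[\mathrm{view}^{V\setminus N[v]}(\mathbf x)\in S]\le e^{\varepsilon}\,\Pr[\mathrm{view}^{V\setminus N[v]}(\mathbf x')\in S].$$ A protocol for *integer aggregation* has a user $w$ who computes a real estimate $\tilde a$ of $\sum_{v\in V}x_v$ from its own input, its coins and the messages that it received. The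 *mean-square error* (MSE) is $\max_{\mathbf x}\mathbb E[(\tilde a-\sum_v x_v)^2]\in[0,\infty]$, with the expectation over the randomness of the protocol. **Theorem.** For every $\varepsilon_0\in\mathbb R$ there is a constant $c>0$, depending only on $\varepsilon_0$, such that for every finite graph $G$, every integer $\Delta\ge 0$ and every $\varepsilon\le\varepsilon_0$, every $(\varepsilon,G)$-TGDP protocol for integer aggregation for which $N[w]\ne V$, or for which the estimate $\tilde a$ is itself an $\varepsilon$-differentially private function of the dataset, has MSE at least $c\,\Delta^2\,\rho(G)$. (The condition $N[w]\neq V$ holds automatically if $\rho(G)\ge 2$, and if $G$ is not complete and the estimate is published to all users, then $w$ can be chosen so that it holds. Some condition is needed: on a complete graph the TGDP condition is void and the users can compute the exact sum.) -/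

import Mathlib

open MeasureTheory

universe u v w z

namespace TrustGraph

/-- The closed neighbourhood `N[a] = N(a) ∪ {a}`. -/
def closedNbhd {V : Type u} (G : SimpleGraph V) (a : V) : Set V :=
  insert a (G.neighborSet a)

/-- A packing: the closed neighbourhoods of distinct elements of `U` are disjoint. -/
def IsPacking {V : Type u} (G : SimpleGraph V) (U : Finset V) : Prop :=
  ∀ a ∈ U, ∀ b ∈ U, a ≠ b → Disjoint (closedNbhd G a) (closedNbhd G b)

/-- The packing number `ρ(G)` of a graph on finitely many vertices: the largest size of a packing.
(On a finite vertex set the sizes are bounded by the number of vertices, and `∅` is a packing.) -/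
noncomputable def packingNumber {V : Type u} [Fintype V] (G : SimpleGraph V) : ℕ :=
  sSup {k : ℕ | ∃ U : Finset V, IsPacking G U ∧ U.card = k}

/-- A randomized interactive protocol among the users `V`, with inputs in `X`.

The users hold independent private coins. There are finitely many synchronous rounds, and in every
round each user sends one message to every user over a private channel (the message space may
contain a symbol for "no message"; a broadcast sends the same message to everybody).
`send t a y r h b` is the message that user `a` sends to user `b` in round `t`, if the input of `a`
is `y`, the coins of `a` are `r`, and `h s c` is the message that `a` received from `c` in the
earlier round `s`. -/
structure Protocol (V : Type u) (X : Type v) where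
  /-- number of rounds -/
  rounds : ℕ
  /-- message space -/
  Msg : Type w
  [msgMeas : MeasurableSpace Msg]
  /-- space of the private coins of each user -/
  Coin : V → Type z
  [coinMeas : ∀ a, MeasurableSpace (Coin a)]
  /-- distribution of the private coins of each user -/
  coinLaw : ∀ a, Measure (Coin a)
  [coinProb : ∀ a, IsProbabilityMeasure (coinLaw a)]
  send : (t : ℕ) → (a : V) → X → Coin a → (Fin t → V → Msg) → V → Msg
  measurable_send : ∀ t a y,
    Measurable (fun p : Coin a × (Fin t → V → Msg) => send t a y p.1 p.2)

attribute [instance] Protocol.msgMeas Protocol.coinMeas Protocol.coinProb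

namespace Protocol

variable {V : Type u} {X : Type v}

/-- `P.message x r t a b` is the message from `a` to `b` in round `t` of the execution of `P` on the
input dataset `x` with coins `r`. -/
def message (P : Protocol.{u, v, w, z} V X) (x : V → X) (r : ∀ a, P.Coin a) (t : ℕ) (a b : V) :
    P.Msg :=
  P.send t a (x a) (r a) (fun s c => message P x r s.1 c a) b
termination_by t
decreasing_by exact s.2

/-- The view of a single user: the input, the received messages (by round and source), and the sent
messages (by round and destination). -/
abbrev View (P : Protocol.{u, v, w, z} V X) : Type (max u v w) :=
  X × (Fin P.rounds → V → P.Msg) × (Fin P.rounds → V → P.Msg)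

/-- The view of user `a` in the execution on input `x` with coins `r`. -/
def userView (P : Protocol.{u, v, w, z} V X) (a : V) (x : V → X) (r : ∀ a, P.Coin a) : P.View :=
  (x a, fun t b => P.message x r t b a, fun t b => P.message x r t a b)

/-- The view of a set `S` of users: the tuple of the views of its members. -/
def view (P : Protocol.{u, v, w, z} V X) (S : Set V) (x : V → X) (r : ∀ a, P.Coin a) :
    S → P.View :=
  fun a => P.userView a x r

/-- The joint distribution of the independent coins of all users. -/
noncomputable def coins [Fintype V] (P : Protocol.{u, v, w, z} V X) : Measure (∀ a, P.Coin a) :=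
  Measure.pi P.coinLaw

/-- `(ε, δ, G)`-Trust Graph DP: for each user `a`, the joint view of the users outside the closed
neighbourhood of `a` is `(ε, δ)`-DP with respect to the input of `a`, for all inputs of the
other users. -/
def IsTGDP [Fintype V] [MeasurableSpace X] (P : Protocol.{u, v, w, z} V X) (G : SimpleGraph V)
    (ε δ : ℝ) : Prop :=
  ∀ (a : V) (x x' : V → X), (∀ b, b ≠ a → x b = x' b) →
    ∀ S : Set (((closedNbhd G a)ᶜ : Set V) → P.View), MeasurableSet S →
      P.coins.real {r | P.view (closedNbhd G a)ᶜ x r ∈ S} ≤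
        Real.exp ε * P.coins.real {r | P.view (closedNbhd G a)ᶜ x' r ∈ S} + δ

end Protocol

/-- A protocol for integer aggregation: every user has an input in `{0, …, Δ}`, and at the end some
user, `outputter`, computes an estimate of the sum of all inputs from all that it knows, i.e.
its own input, its own coins, and the messages that it received. -/
structure AggregationProtocol (V : Type u) (Δ : ℕ) extends
    Protocol.{u, 0, w, z} V (Fin (Δ + 1)) where
  outputter : V
  output : Fin (Δ + 1) → Coin outputter → (Fin rounds → V → Msg) → ℝ
  measurable_output : ∀ y,
    Measurable (fun p : Coin outputter × (Fin rounds → V → Msg) => output y p.1 p.2)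

namespace AggregationProtocol

variable {V : Type u} {Δ : ℕ}

/-- The estimate produced in the execution on input `x` with coins `r`. -/
def estimate (A : AggregationProtocol.{u, w, z} V Δ) (x : V → Fin (Δ + 1))
    (r : ∀ a, A.Coin a) : ℝ :=
  A.output (x A.outputter) (r A.outputter)
    (fun t b => A.toProtocol.message x r t b A.outputter)

/-- The estimate, as a randomized function of the dataset, is `(ε, δ)`-DP in the ordinary (central)
sense. -/
def EstimateIsDP [Fintype V] (A : AggregationProtocol.{u, w, z} V Δ) (ε δ : ℝ) : Prop :=
  ∀ (a : V) (x x' : V → Fin (Δ + 1)), (∀ b, b ≠ a → x b = x' b) →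
    ∀ S : Set ℝ, MeasurableSet S →
      A.toProtocol.coins.real {r | A.estimate x r ∈ S} ≤
        Real.exp ε * A.toProtocol.coins.real {r | A.estimate x' r ∈ S} + δ

/-- The mean-square error: the expectation, over the randomness of the protocol, of the squared
difference of the estimate and the true sum, for the worst input dataset. -/
noncomputable def mse [Fintype V] (A : AggregationProtocol.{u, w, z} V Δ) : ENNReal :=
  ⨆ x : V → Fin (Δ + 1),
    ∫⁻ r, ENNReal.ofReal ((A.estimate x r - ∑ a, ((x a : ℕ) : ℝ)) ^ 2) ∂A.toProtocol.coins

end AggregationProtocol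

end TrustGraph

/-!
Every user `a` gets an independent fair bit; the bits of the members `a` of a packing `U` decide
between the inputs `0` and `Δ`, and all other inputs are `0`. The maximal error over all datasets is
at least the average error in this experiment, and the latter is large because the sum has a large
variance given everything that the outputter sees.

For `a ∈ U` let `S = N[a]`, and let `𝓖ₐ` be the σ-algebra of the messages that cross the boundary of
`S`. By induction on the rounds, the randomness inside `S` and the randomness outside `S` are
conditionally independent given `𝓖ₐ` (`Protocol.screenedOff_crossSigma`): a new crossing message is
a function of the randomness on the side of its sender and of the earlier crossing messages.
Conditional independence is used in the form "the conditional probability of an event of one side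
does not change when the other side is added to `𝓖ₐ`", for which the induction step is the tower
property (`ScreenedOff.sup_right`), once the symmetry between the two sides is known
(`ScreenedOff.symm`). No regular conditional distributions are needed, so the message and coin
spaces may be arbitrary measurable spaces.

Let `gₐ` be the conditional probability, given `𝓖ₐ`, that the bit of `a` is set, and
`Dₐ = 1{bit of a is set} - gₐ`. The crossing messages belong to the view of the users outside `N[a]`,
so by privacy `gₐ` lies between `p` and `1 - p` for `p = 1 / (1 + exp ε₀)`
(`Protocol.IsTGDP.ae_condExp_bit_mem_Icc`), and hence `|Dₐ| ≥ p`. By conditional independence, `Dₐ`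
is orthogonal to everything that is determined by the randomness outside `N[a]` and the crossing
messages. This comprises the `D_b` of the other members `b` of the packing, all the `g_b`, and the
estimate, if the outputter is outside `N[a]`. Expanding the square thus gives a mean-square error
of at least `|U| p² Δ²` (`card_mul_le_integral_sub_sum_sq`,
`AggregationProtocol.card_packing_le_mse`).

The outputter lies in at most one of the disjoint neighbourhoods, and dropping that one costs at
most a factor of two if the packing has at least two members. A packing number of at most one is
treated by a packing `{a}` with the outputter outside `N[a]`, or, if the estimate itself is
differentially private, by comparing two datasets whose sums differ by `Δ`
(`AggregationProtocol.EstimateIsDP.sq_div_four_le_mse`).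
-/

namespace TrustGraph

/-! ### Conditional independence through conditional probabilities -/

section ConditionalIndependence

variable {Ω : Type*} {m₀ : MeasurableSpace Ω} {μ : Measure Ω}

/-- By the π-λ theorem, set integrals over `m₁ ⊔ m₂` are determined by those over intersections of a
set of `m₁` and a set of `m₂`. -/
theorem setIntegral_eq_of_sup {m₁ m₂ : MeasurableSpace Ω} (h₁ : m₁ ≤ m₀) (h₂ : m₂ ≤ m₀)
    {f g : Ω → ℝ} (hf : Integrable f μ) (hg : Integrable g μ)
    (h : ∀ s t, MeasurableSet[m₁] s → MeasurableSet[m₂] t →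
      ∫ ω in s ∩ t, f ω ∂μ = ∫ ω in s ∩ t, g ω ∂μ)
    {E : Set Ω} (hE : MeasurableSet[m₁ ⊔ m₂] E) :
    ∫ ω in E, f ω ∂μ = ∫ ω in E, g ω ∂μ := by
  have huniv : ∫ ω, f ω ∂μ = ∫ ω, g ω ∂μ := by
    simpa using h Set.univ Set.univ MeasurableSet.univ MeasurableSet.univ
  have hsup : m₁ ⊔ m₂ = MeasurableSpace.generateFrom
      (Set.image2 (· ∩ ·) {s | MeasurableSet[m₁] s} {t | MeasurableSet[m₂] t}) := by
    apply le_antisymm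
    · refine sup_le (fun s hs => ?_) (fun t ht => ?_)
      · exact MeasurableSpace.measurableSet_generateFrom
          ⟨s, hs, Set.univ, MeasurableSet.univ, Set.inter_univ s⟩
      · exact MeasurableSpace.measurableSet_generateFrom
          ⟨Set.univ, MeasurableSet.univ, t, ht, Set.univ_inter t⟩
    · refine MeasurableSpace.generateFrom_le ?_
      rintro _ ⟨s, hs, t, ht, rfl⟩
      exact MeasurableSet.inter (le_sup_left (b := m₂) s hs) (le_sup_right (a := m₁) t ht)
  have hpi : IsPiSystem
      (Set.image2 (· ∩ ·) {s | MeasurableSet[m₁] s} {t | MeasurableSet[m₂] t}) := by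
    rintro _ ⟨s, hs, t, ht, rfl⟩ _ ⟨s', hs', t', ht', rfl⟩ -
    exact ⟨s ∩ s', MeasurableSet.inter hs hs', t ∩ t', MeasurableSet.inter ht ht',
      Set.inter_inter_inter_comm ..⟩
  have hle : m₁ ⊔ m₂ ≤ m₀ := sup_le h₁ h₂
  induction E, hE using MeasurableSpace.induction_on_inter hsup hpi with
  | empty => simp
  | basic t ht =>
    obtain ⟨s, hs, t, ht, rfl⟩ := ht
    exact h s t hs ht
  | compl t htm ih =>
    rw [setIntegral_compl (hle _ htm) hf, setIntegral_compl (hle _ htm) hg, ih, huniv]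
  | iUnion t hd htm ih =>
    rw [integral_iUnion (fun i => hle _ (htm i)) hd hf.integrableOn,
      integral_iUnion (fun i => hle _ (htm i)) hd hg.integrableOn]
    exact tsum_congr ih

variable [IsProbabilityMeasure μ]

/-- The indicator of an event, as a real random variable. -/
noncomputable def eventIndicator (S : Set Ω) : Ω → ℝ := S.indicator fun _ => 1

theorem integrable_eventIndicator {S : Set Ω} (hS : MeasurableSet S) :
    Integrable (eventIndicator S) μ :=
  (integrable_const 1).indicator hS

/-- Conditional independence of `m₁` and `m₂` given `mg`: adding the information of `m₂` to that of
`mg` does not change the conditional probabilities of the events of `m₁`. In contrast to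
`ProbabilityTheory.CondIndep`, this makes sense and is usable without a standard Borel space. -/
def ScreenedOff (μ : Measure Ω) (m₁ m₂ mg : MeasurableSpace Ω) : Prop :=
  ∀ S, MeasurableSet[m₁] S →
    μ[eventIndicator S | m₂ ⊔ mg] =ᵐ[μ] μ[eventIndicator S | mg]

/-- The pull-out property, integrated over an event of `mg`. -/
theorem setIntegral_inter_eq_mul_condExp {mg : MeasurableSpace Ω} (hg : mg ≤ m₀)
    {S G : Set Ω} (hS : MeasurableSet[m₀] S) (hG : MeasurableSet[mg] G) {h : Ω → ℝ}
    (hm : StronglyMeasurable[mg] h) (hi : Integrable h μ) :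
    ∫ ω in S ∩ G, h ω ∂μ = ∫ ω in G, μ[eventIndicator S | mg] ω * h ω ∂μ := by
  have hprod : eventIndicator S * h = S.indicator h := by
    ext ω
    by_cases hω : ω ∈ S <;> simp [eventIndicator, hω]
  have hint : Integrable (eventIndicator S * h) μ := by
    rw [hprod]; exact hi.indicator hS
  have h1 := condExp_mul_of_stronglyMeasurable_right (μ := μ) hm hint
    (integrable_eventIndicator hS)
  calc ∫ ω in S ∩ G, h ω ∂μ = ∫ ω in G, (eventIndicator S * h) ω ∂μ := by
        rw [hprod, setIntegral_indicator hS, Set.inter_comm]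
    _ = ∫ ω in G, μ[eventIndicator S * h | mg] ω ∂μ := (setIntegral_condExp hg hint hG).symm
    _ = _ := integral_congr_ae (ae_restrict_of_ae h1)

/-- Conditional independence is symmetric: for `S` in `m₁`, `B` in `m₂` and `G` in `mg`, both orders
give the integral over `G` of the product of the conditional probabilities of `S` and `B`. -/
theorem ScreenedOff.symm {m₁ m₂ mg : MeasurableSpace Ω} (h₁ : m₁ ≤ m₀) (h₂ : m₂ ≤ m₀)
    (hg : mg ≤ m₀) (h : ScreenedOff μ m₁ m₂ mg) : ScreenedOff μ m₂ m₁ mg := by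
  intro B hB
  refine (ae_eq_condExp_of_forall_setIntegral_eq (sup_le h₁ hg)
    (integrable_eventIndicator (h₂ _ hB)) (fun _ _ _ => integrable_condExp.integrableOn) ?_
    (stronglyMeasurable_condExp.mono (le_sup_right (a := m₁))).aestronglyMeasurable).symm
  intro E hE _
  refine setIntegral_eq_of_sup h₁ hg integrable_condExp (integrable_eventIndicator (h₂ _ hB)) ?_ hE
  intro S G hS hG
  have hreal : ∀ {C D : Set Ω}, MeasurableSet[m₀] D →
      ∫ ω in C, eventIndicator D ω ∂μ = μ.real (C ∩ D) := by
    intro C D hD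
    rw [eventIndicator, setIntegral_indicator hD]
    simp
  have hBG : MeasurableSet[m₂ ⊔ mg] (B ∩ G) :=
    MeasurableSet.inter (le_sup_left (b := mg) B hB) (le_sup_right (a := m₂) G hG)
  calc ∫ ω in S ∩ G, μ[eventIndicator B | mg] ω ∂μ
      = ∫ ω in G, μ[eventIndicator S | mg] ω * μ[eventIndicator B | mg] ω ∂μ :=
        setIntegral_inter_eq_mul_condExp hg (h₁ _ hS) hG stronglyMeasurable_condExp
          integrable_condExp
    _ = ∫ ω in B ∩ G, μ[eventIndicator S | mg] ω ∂μ := by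
        rw [setIntegral_inter_eq_mul_condExp hg (h₂ _ hB) hG stronglyMeasurable_condExp
          integrable_condExp]
        simp only [mul_comm]
    _ = ∫ ω in B ∩ G, μ[eventIndicator S | m₂ ⊔ mg] ω ∂μ :=
        integral_congr_ae (ae_restrict_of_ae (h S hS).symm)
    _ = ∫ ω in B ∩ G, eventIndicator S ω ∂μ :=
        setIntegral_condExp (sup_le h₂ hg) (integrable_eventIndicator (h₁ _ hS)) hBG
    _ = ∫ ω in S ∩ G, eventIndicator B ω ∂μ := by
        rw [hreal (h₁ _ hS), hreal (h₂ _ hB)]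
        congr 1
        ext; simp; tauto

/-- Conditional independence persists when the condition is refined by information that the second
side can compute, here a message of that side. -/
theorem ScreenedOff.sup_right {m₁ m₂ mg mh : MeasurableSpace Ω} (h₂ : m₂ ≤ m₀) (hg : mg ≤ m₀)
    (hh : mh ≤ m₂ ⊔ mg) (h : ScreenedOff μ m₁ m₂ mg) : ScreenedOff μ m₁ m₂ (mg ⊔ mh) := by
  intro S hS
  have hle : m₂ ⊔ mg ≤ m₀ := sup_le h₂ hg
  have hsup : m₂ ⊔ (mg ⊔ mh) = m₂ ⊔ mg := by
    rw [← sup_assoc, sup_eq_left.2 hh]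
  have hgh : mg ⊔ mh ≤ m₂ ⊔ mg := sup_le le_sup_right hh
  rw [hsup]
  calc μ[eventIndicator S | m₂ ⊔ mg] =ᵐ[μ] μ[eventIndicator S | mg] := h S hS
    _ = μ[μ[eventIndicator S | mg] | mg ⊔ mh] :=
        (condExp_of_stronglyMeasurable (hgh.trans hle)
          (stronglyMeasurable_condExp.mono le_sup_left) integrable_condExp).symm
    _ =ᵐ[μ] μ[μ[eventIndicator S | m₂ ⊔ mg] | mg ⊔ mh] := condExp_congr_ae (h S hS).symm
    _ =ᵐ[μ] μ[eventIndicator S | mg ⊔ mh] := condExp_condExp_of_le hgh hle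

theorem ScreenedOff.of_indep {m₁ m₂ : MeasurableSpace Ω} (h₁ : m₁ ≤ m₀) (h₂ : m₂ ≤ m₀)
    (h : ProbabilityTheory.Indep m₁ m₂ μ) : ScreenedOff μ m₁ m₂ ⊥ := by
  intro S hS
  rw [sup_bot_eq, condExp_bot]
  exact condExp_indep_eq h₁ h₂ (stronglyMeasurable_const.indicator hS) h

/-- Bounds for the conditional probability of `S`, from bounds for the relative frequency of `S` in
the events of `mg`. -/
theorem ae_condExp_eventIndicator_mem_Icc {mg : MeasurableSpace Ω} (hg : mg ≤ m₀)
    {S : Set Ω} (hS : MeasurableSet[m₀] S) {p q : ℝ}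
    (h : ∀ E, MeasurableSet[mg] E →
      p * μ.real E ≤ μ.real (E ∩ S) ∧ μ.real (E ∩ S) ≤ q * μ.real E) :
    ∀ᵐ ω ∂μ, μ[eventIndicator S | mg] ω ∈ Set.Icc p q := by
  -- Comparing set integrals over the events of `mg` alone requires the trimmed measure.
  have hgm : StronglyMeasurable[mg] (μ[eventIndicator S | mg]) := stronglyMeasurable_condExp
  have hgi : Integrable (μ[eventIndicator S | mg]) (μ.trim hg) :=
    integrable_condExp.trim hg hgm
  have hconst : ∀ (c : ℝ) (E : Set Ω), MeasurableSet[mg] E →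
      ∫ _ in E, c ∂(μ.trim hg) = c * μ.real E := by
    intro c E hE
    rw [setIntegral_const, smul_eq_mul, mul_comm, measureReal_def, trim_measurableSet_eq hg hE,
      measureReal_def]
  have hset : ∀ E : Set Ω, MeasurableSet[mg] E →
      ∫ ω in E, μ[eventIndicator S | mg] ω ∂(μ.trim hg) = μ.real (E ∩ S) := by
    intro E hE
    rw [← setIntegral_trim hg hgm hE, setIntegral_condExp hg (integrable_eventIndicator hS) hE,
      eventIndicator, setIntegral_indicator hS]
    simp
  have hlow := ae_of_ae_trim hg (ae_le_of_forall_setIntegral_le (integrable_const p) hgi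
    fun E hE _ => by rw [hconst p E hE, hset E hE]; exact (h E hE).1)
  have hupp := ae_of_ae_trim hg (ae_le_of_forall_setIntegral_le hgi (integrable_const q)
    fun E hE _ => by rw [hconst q E hE, hset E hE]; exact (h E hE).2)
  filter_upwards [hlow, hupp] with ω h₁ h₂ using ⟨h₁, h₂⟩

end ConditionalIndependence

/-! ### A variance bound for sums of orthogonal errors -/

section Orthogonality

variable {Ω ι : Type*} {m₀ : MeasurableSpace Ω} {μ : Measure Ω} [IsProbabilityMeasure μ]

theorem integral_mul_eq_zero_of_condExp_eq_zero {m : MeasurableSpace Ω} (hm : m ≤ m₀)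
    {D Y : Ω → ℝ} (hD : MemLp D 2 μ) (hY : MemLp Y 2 μ) (hYm : StronglyMeasurable[m] Y)
    (h0 : μ[D | m] =ᵐ[μ] 0) : ∫ ω, D ω * Y ω ∂μ = 0 := by
  have hint : Integrable (D * Y) μ := hD.integrable_mul hY
  have h1 := condExp_mul_of_stronglyMeasurable_right (μ := μ) hYm hint
    (hD.integrable (by norm_num))
  calc ∫ ω, D ω * Y ω ∂μ = ∫ ω, μ[D * Y | m] ω ∂μ := (integral_condExp hm).symm
    _ = ∫ _, (0 : ℝ) ∂μ := by
        refine integral_congr_ae ?_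
        filter_upwards [h1, h0] with ω h h'
        rw [h, Pi.mul_apply, h']
        simp
    _ = 0 := by simp

/-- If every `D i` has absolute value at least `p` and is orthogonal to a σ-algebra `m i` that
contains `R` and the other `D j`, then the mutually orthogonal `D i` cannot be cancelled by `R`: each
of them contributes at least `p² d²` to the mean square of `R - d ∑ D i`. -/
theorem card_mul_le_integral_sub_sum_sq (U : Finset ι) {m : ι → MeasurableSpace Ω}
    (hm : ∀ i ∈ U, m i ≤ m₀) {D : ι → Ω → ℝ} {R : Ω → ℝ} {d p : ℝ} (hp : 0 ≤ p)
    (hD : ∀ i ∈ U, MemLp (D i) 2 μ) (hDp : ∀ i ∈ U, ∀ᵐ ω ∂μ, p ≤ |D i ω|)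
    (hDm : ∀ i ∈ U, ∀ j ∈ U, j ≠ i → StronglyMeasurable[m i] (D j))
    (hD0 : ∀ i ∈ U, μ[D i | m i] =ᵐ[μ] 0)
    (hR : MemLp R 2 μ) (hRm : ∀ i ∈ U, StronglyMeasurable[m i] R) :
    (U.card : ℝ) * (p ^ 2 * d ^ 2) ≤ ∫ ω, (R ω - d * ∑ i ∈ U, D i ω) ^ 2 ∂μ := by
  classical
  suffices H : ∀ T ⊆ U, (T.card : ℝ) * (p ^ 2 * d ^ 2) ≤
      ∫ ω, (R ω - d * ∑ i ∈ T, D i ω) ^ 2 ∂μ from H U subset_rfl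
  intro T
  -- Only the newest `D i` is split off, so that everything else is measurable for `m i`.
  induction T using Finset.induction_on with
  | empty =>
    intro _
    simpa using integral_nonneg (fun ω => sq_nonneg (R ω))
  | insert i T hi ih =>
    intro hT
    have hiU : i ∈ U := hT (Finset.mem_insert_self i T)
    have hTU : T ⊆ U := fun j hj => hT (Finset.mem_insert_of_mem hj)
    set Y : Ω → ℝ := fun ω => R ω - d * ∑ j ∈ T, D j ω with hYdef
    have hY : MemLp Y 2 μ :=
      hR.sub ((memLp_finsetSum T fun j hj => hD j (hTU hj)).const_mul d)
    have hYm : StronglyMeasurable[m i] Y := by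
      refine (hRm i hiU).sub (StronglyMeasurable.const_mul ?_ d)
      refine Finset.stronglyMeasurable_fun_sum T fun j hj => ?_
      exact hDm i hiU j (hTU hj) (fun e => hi (e ▸ hj))
    have hDY := integral_mul_eq_zero_of_condExp_eq_zero (hm i hiU) (hD i hiU) hY hYm (hD0 i hiU)
    have hDsq : p ^ 2 ≤ ∫ ω, D i ω ^ 2 ∂μ := by
      calc p ^ 2 = ∫ _, p ^ 2 ∂μ := by simp
        _ ≤ _ := by
          refine integral_mono_ae (integrable_const _) (hD i hiU).integrable_sq ?_
          filter_upwards [hDp i hiU] with ω hω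
          rw [← sq_abs (D i ω)]
          exact pow_le_pow_left₀ hp hω 2
    have hexp : ∀ ω, (R ω - d * ∑ j ∈ insert i T, D j ω) ^ 2 =
        Y ω ^ 2 - 2 * d * (D i ω * Y ω) + d ^ 2 * D i ω ^ 2 := by
      intro ω
      rw [Finset.sum_insert hi, hYdef]
      ring
    have hYi : Integrable (fun ω => Y ω ^ 2) μ := hY.integrable_sq
    have hDYi : Integrable (fun ω => D i ω * Y ω) μ := (hD i hiU).integrable_mul hY
    have hsplit : ∫ ω, (R ω - d * ∑ j ∈ insert i T, D j ω) ^ 2 ∂μ =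
        ∫ ω, Y ω ^ 2 ∂μ + d ^ 2 * ∫ ω, D i ω ^ 2 ∂μ := by
      have hsub : Integrable (fun ω => Y ω ^ 2 - 2 * d * (D i ω * Y ω)) μ :=
        hYi.sub (hDYi.const_mul _)
      simp_rw [hexp]
      rw [integral_add hsub ((hD i hiU).integrable_sq.const_mul _),
        integral_sub hYi (hDYi.const_mul _), integral_const_mul, integral_const_mul, hDY]
      ring
    rw [hsplit, Finset.card_insert_of_notMem hi]
    have := ih hTU
    push_cast
    nlinarith [mul_le_mul_of_nonneg_left hDsq (sq_nonneg d)]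

end Orthogonality

/-! ### Executions on random inputs -/

/-- The law of a fair coin. -/
noncomputable def fairBit : Measure Bool := (2 : ENNReal)⁻¹ • Measure.count

instance : IsProbabilityMeasure fairBit :=
  ⟨by
    rw [fairBit, Measure.smul_apply, Measure.count_apply MeasurableSet.univ, Set.encard_univ,
      ENat.card_eq_coe_fintype_card, Fintype.card_bool, smul_eq_mul]
    exact ENNReal.inv_mul_cancel (by norm_num) (by norm_num)⟩

namespace Protocol

variable {V : Type u} {X : Type v} (P : Protocol.{u, v, w, z} V X)

/-- The randomness of an execution on random inputs: each user holds a random bit, to select its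
input, in addition to its private coins. -/
abbrev BitCoins : Type (max u z) := ∀ a, Bool × P.Coin a

/-- The joint law of independent fair bits and the private coins of the protocol. -/
noncomputable def bitCoins [Fintype V] : Measure P.BitCoins :=
  Measure.pi fun a => fairBit.prod (P.coinLaw a)

instance [Fintype V] : IsProbabilityMeasure P.coins := by
  unfold coins; infer_instance

instance [Fintype V] : IsProbabilityMeasure P.bitCoins := by
  unfold bitCoins; infer_instance

theorem measurable_withBits (s : V → Bool) :
    Measurable fun (r : ∀ a, P.Coin a) a => (s a, r a) := by
  fun_prop

/-- The law of the bits and coins is the average, over all bit vectors, of the law of the coins. -/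
theorem bitCoins_eq_sum [Fintype V] [DecidableEq V] :
    P.bitCoins = ∑ s : V → Bool,
      ((2 : ENNReal)⁻¹ ^ Fintype.card V) • P.coins.map (fun r a => (s a, r a)) := by
  refine (Measure.pi_eq fun E hE => ?_)
  have hfac : ∀ a, fairBit.prod (P.coinLaw a) (E a) =
      ∑ i : Bool, (2 : ENNReal)⁻¹ * P.coinLaw a (Prod.mk i ⁻¹' E a) := by
    intro a
    rw [Measure.prod_apply (hE a), fairBit, lintegral_smul_measure, lintegral_count,
      tsum_fintype, smul_eq_mul, Finset.mul_sum]
  simp_rw [hfac]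
  rw [Finset.prod_univ_sum, Fintype.piFinset_univ, Measure.finsetSum_apply]
  refine Finset.sum_congr rfl fun s _ => ?_
  rw [Measure.smul_apply, Measure.map_apply (P.measurable_withBits s) (MeasurableSet.univ_pi hE),
    smul_eq_mul, Finset.prod_mul_distrib, Finset.prod_const, Finset.card_univ]
  congr 1
  rw [coins, ← Measure.pi_pi]
  congr 1

theorem bitCoins_real_eq_sum [Fintype V] [DecidableEq V] {E : Set P.BitCoins}
    (hE : MeasurableSet E) :
    P.bitCoins.real E = ∑ s : V → Bool,
      (2 : ℝ)⁻¹ ^ Fintype.card V * P.coins.real {r | (fun a => (s a, r a)) ∈ E} := by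
  rw [bitCoins_eq_sum, measureReal_def, Measure.finsetSum_apply, ENNReal.toReal_sum]
  · refine Finset.sum_congr rfl fun s _ => ?_
    rw [Measure.smul_apply, smul_eq_mul, ENNReal.toReal_mul,
      Measure.map_apply (P.measurable_withBits s) hE]
    simp [measureReal_def]
    rfl
  · intro s _
    rw [Measure.smul_apply, smul_eq_mul]
    rw [Measure.map_apply (P.measurable_withBits s) hE]
    exact ENNReal.mul_ne_top (by simp) (measure_ne_top _ _)

theorem lintegral_bitCoins_le [Fintype V] {F : P.BitCoins → ENNReal} (hF : Measurable F)
    {M : ENNReal} (h : ∀ s : V → Bool, ∫⁻ r, F (fun a => (s a, r a)) ∂P.coins ≤ M) :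
    ∫⁻ ω, F ω ∂P.bitCoins ≤ M := by
  classical
  rw [bitCoins_eq_sum, lintegral_finsetSum_measure]
  calc _ ≤ ∑ _s : V → Bool, (2 : ENNReal)⁻¹ ^ Fintype.card V * M := by
        refine Finset.sum_le_sum fun s _ => ?_
        rw [lintegral_smul_measure, lintegral_map hF (P.measurable_withBits s), smul_eq_mul]
        exact mul_le_mul_right (h s) _
    _ = M := by
        rw [Finset.sum_const, Finset.card_univ, Fintype.card_fun, Fintype.card_bool, nsmul_eq_mul,
          ← mul_assoc, Nat.cast_pow, ← mul_pow, Nat.cast_ofNat,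
          ENNReal.mul_inv_cancel (by norm_num) (by norm_num), one_pow, one_mul]

/-! ### Messages that cross the boundary of a set of users -/

/-- The message from `a` to `b` in round `t`, where user `c` has the input `inp c i` if `i` is its
bit. -/
def bitMessage (inp : V → Bool → X) (ω : P.BitCoins) (t : ℕ) (a b : V) : P.Msg :=
  P.message (fun c => inp c (ω c).1) (fun c => (ω c).2) t a b

variable (inp : V → Bool → X)

/-- A message is measurable for any σ-algebra that knows the bit and the coins of the sender and the
messages that the sender received earlier. -/
theorem measurable_bitMessage_of {m : MeasurableSpace P.BitCoins} {t : ℕ} {a b : V}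
    (ha : Measurable[m] fun ω : P.BitCoins => ω a)
    (hrec : ∀ s < t, ∀ c, Measurable[m] fun ω => P.bitMessage inp ω s c a) :
    Measurable[m] fun ω => P.bitMessage inp ω t a b := by
  have hsend : Measurable fun q : (Bool × P.Coin a) × (Fin t → V → P.Msg) =>
      P.send t a (inp a q.1.1) q.1.2 q.2 b := by
    have : Measurable fun q : Bool × (P.Coin a × (Fin t → V → P.Msg)) =>
        P.send t a (inp a q.1) q.2.1 q.2.2 b :=
      measurable_from_prod_countable_right fun i =>
        (measurable_pi_apply b).comp (P.measurable_send t a (inp a i))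
    exact this.comp (measurable_fst.fst.prodMk (measurable_fst.snd.prodMk measurable_snd))
  have harg : Measurable[m] fun ω : P.BitCoins =>
      (ω a, fun (s : Fin t) c => P.bitMessage inp ω s.1 c a) :=
    ha.prodMk (measurable_pi_lambda _ fun s => measurable_pi_lambda _ fun c => hrec s.1 s.2 c)
  have heq : (fun ω => P.bitMessage inp ω t a b) = fun ω =>
      P.send t a (inp a (ω a).1) (ω a).2 (fun (s : Fin t) c => P.bitMessage inp ω s.1 c a) b := by
    funext ω
    unfold bitMessage
    rw [message]
  rw [heq]
  exact hsend.comp harg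

theorem measurable_bitMessage (t : ℕ) : ∀ a b : V,
    Measurable fun ω => P.bitMessage inp ω t a b := by
  induction t using Nat.strong_induction_on with
  | _ t ih =>
    intro a b
    exact P.measurable_bitMessage_of inp (measurable_pi_apply a) fun s hs c => ih s hs c a

/-- The σ-algebra of the bits and coins of the users in `S`. -/
@[reducible]
def blockSigma (S : Set V) : MeasurableSpace P.BitCoins :=
  ⨆ a ∈ S, MeasurableSpace.comap (fun ω => ω a) inferInstance

/-- The σ-algebra of the messages that users in `S` send to users outside `S` in round `t`. -/
@[reducible]
def sentSigma (S : Set V) (t : ℕ) : MeasurableSpace P.BitCoins :=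
  ⨆ a ∈ S, ⨆ b ∈ Sᶜ, MeasurableSpace.comap (fun ω => P.bitMessage inp ω t a b) inferInstance

/-- The σ-algebra of all messages between `S` and its complement, in both directions, in the rounds
before the given one. -/
@[reducible]
def crossSigma (S : Set V) : ℕ → MeasurableSpace P.BitCoins
  | 0 => ⊥
  | t + 1 => crossSigma S t ⊔ P.sentSigma inp S t ⊔ P.sentSigma inp Sᶜ t

theorem blockSigma_le (S : Set V) : P.blockSigma S ≤ MeasurableSpace.pi :=
  iSup₂_le fun a _ => (measurable_pi_apply a).comap_le

theorem measurable_coord {S : Set V} {a : V} (ha : a ∈ S) :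
    Measurable[P.blockSigma S] fun ω : P.BitCoins => ω a :=
  measurable_iff_comap_le.2 (le_iSup₂_of_le a ha le_rfl)

theorem crossSigma_compl (S : Set V) (t : ℕ) :
    P.crossSigma inp Sᶜ t = P.crossSigma inp S t := by
  induction t with
  | zero => rfl
  | succ t ih => rw [crossSigma, crossSigma, ih, compl_compl, sup_assoc, sup_assoc,
      sup_comm (P.sentSigma inp Sᶜ t)]

theorem crossSigma_mono (S : Set V) : Monotone (P.crossSigma inp S) :=
  monotone_nat_of_le_succ fun t => by
    rw [crossSigma, sup_assoc]; exact le_sup_left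

theorem crossSigma_le {S : Set V} {n : ℕ} {m : MeasurableSpace P.BitCoins}
    (h : ∀ t < n, ∀ a b, (a ∈ S ∧ b ∉ S) ∨ (a ∉ S ∧ b ∈ S) →
      Measurable[m] fun ω => P.bitMessage inp ω t a b) :
    P.crossSigma inp S n ≤ m := by
  induction n with
  | zero => exact bot_le
  | succ n ih =>
    refine sup_le (sup_le (ih fun t ht => h t (by omega)) ?_) ?_
    · exact iSup₂_le fun a ha => iSup₂_le fun b hb =>
        (h n (by omega) a b (Or.inl ⟨ha, hb⟩)).comap_le
    · exact iSup₂_le fun a ha => iSup₂_le fun b hb =>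
        (h n (by omega) a b (Or.inr ⟨ha, not_not.1 hb⟩)).comap_le

theorem crossSigma_le_pi (S : Set V) (n : ℕ) : P.crossSigma inp S n ≤ MeasurableSpace.pi :=
  P.crossSigma_le inp fun t _ a b _ => P.measurable_bitMessage inp t a b

theorem measurable_bitMessage_cross {S : Set V} {t n : ℕ} (ht : t < n) {a b : V}
    (h : (a ∈ S ∧ b ∉ S) ∨ (a ∉ S ∧ b ∈ S)) :
    Measurable[P.crossSigma inp S n] fun ω => P.bitMessage inp ω t a b := by
  refine measurable_iff_comap_le.2 (le_trans ?_ (P.crossSigma_mono inp S (Nat.succ_le_of_lt ht)))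
  rcases h with ⟨ha, hb⟩ | ⟨ha, hb⟩
  · have hle : MeasurableSpace.comap (fun ω => P.bitMessage inp ω t a b) inferInstance ≤
        P.sentSigma inp S t := le_iSup₂_of_le a ha (le_iSup₂_of_le b hb le_rfl)
    exact (hle.trans le_sup_right).trans le_sup_left
  · have hle : MeasurableSpace.comap (fun ω => P.bitMessage inp ω t a b) inferInstance ≤
        P.sentSigma inp Sᶜ t := le_iSup₂_of_le a ha (le_iSup₂_of_le b (not_not.2 hb) le_rfl)
    exact hle.trans le_sup_right

/-- What a user in `S` sends is determined by the randomness inside `S` and the earlier crossing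
messages: the messages that it has received come from inside `S` or cross the boundary. -/
theorem measurable_bitMessage_sent {S : Set V} (t : ℕ) : ∀ {a : V} (b : V), a ∈ S →
    Measurable[P.blockSigma S ⊔ P.crossSigma inp S t] fun ω => P.bitMessage inp ω t a b := by
  induction t using Nat.strong_induction_on with
  | _ t ih =>
    intro a b ha
    refine P.measurable_bitMessage_of inp ((P.measurable_coord ha).mono le_sup_left le_rfl) ?_
    intro s hs c
    by_cases hc : c ∈ S
    · exact (ih s hs a hc).mono (sup_le_sup_left (P.crossSigma_mono inp S hs.le) _) le_rfl
    · exact (P.measurable_bitMessage_cross inp hs (Or.inr ⟨hc, ha⟩)).mono le_sup_right le_rfl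

/-- A message with an endpoint outside `S` is determined by the randomness outside `S` and the
crossing messages. -/
theorem measurable_bitMessage_outside {S : Set V} {t n : ℕ} (ht : t < n) {a b : V}
    (h : a ∉ S ∨ b ∉ S) :
    Measurable[P.blockSigma Sᶜ ⊔ P.crossSigma inp S n] fun ω => P.bitMessage inp ω t a b := by
  by_cases ha : a ∈ S
  · exact (P.measurable_bitMessage_cross inp ht
      (Or.inl ⟨ha, h.resolve_left (not_not.2 ha)⟩)).mono le_sup_right le_rfl
  · have h1 := P.measurable_bitMessage_sent inp (S := Sᶜ) t b ha
    rw [crossSigma_compl] at h1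
    exact h1.mono (sup_le_sup_left (P.crossSigma_mono inp S ht.le) _) le_rfl

theorem sentSigma_le (S : Set V) (t : ℕ) :
    P.sentSigma inp S t ≤ P.blockSigma S ⊔ P.crossSigma inp S t :=
  iSup₂_le fun _ ha => iSup₂_le fun b _ => (P.measurable_bitMessage_sent inp t b ha).comap_le

theorem indep_blockSigma [Fintype V] (S : Set V) :
    ProbabilityTheory.Indep (P.blockSigma S) (P.blockSigma Sᶜ) P.bitCoins := by
  refine ProbabilityTheory.indep_iSup_of_disjoint (fun a => (measurable_pi_apply a).comap_le) ?_
    disjoint_compl_right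
  exact ProbabilityTheory.iIndepFun_pi (X := fun _ => id) fun _ => aemeasurable_id

/-- The two sides of a cut are conditionally independent given the messages that cross it. -/
theorem screenedOff_crossSigma [Fintype V] (S : Set V) (n : ℕ) :
    ScreenedOff P.bitCoins (P.blockSigma S) (P.blockSigma Sᶜ) (P.crossSigma inp S n) := by
  have hb := P.blockSigma_le
  induction n with
  | zero => exact ScreenedOff.of_indep (hb _) (hb _) (P.indep_blockSigma S)
  | succ n ih =>
    have hc := P.crossSigma_le_pi inp S n
    have hs : P.sentSigma inp S n ≤ P.blockSigma S ⊔ P.crossSigma inp S n :=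
      P.sentSigma_le inp S n
    have hs' : P.sentSigma inp Sᶜ n ≤
        P.blockSigma Sᶜ ⊔ (P.crossSigma inp S n ⊔ P.sentSigma inp S n) := by
      refine (P.sentSigma_le inp Sᶜ n).trans ?_
      rw [crossSigma_compl]
      exact sup_le_sup_left le_sup_left _
    -- The messages from inside refine the condition first, then those from outside.
    have h1 := (ih.symm (hb _) (hb _) hc).sup_right (hb _) hc hs
    have hc' : P.crossSigma inp S n ⊔ P.sentSigma inp S n ≤ MeasurableSpace.pi :=
      sup_le hc (hs.trans (sup_le (hb _) hc))
    exact (h1.symm (hb _) (hb _) hc').sup_right (hb _) hc' hs'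

/-! ### Privacy bounds the information in the crossing messages -/

/-- A message that crosses the boundary of `S` is received or sent by a user outside `S`. -/
theorem crossSigma_le_comap_view [MeasurableSpace X] (S : Set V) :
    P.crossSigma inp S P.rounds ≤ MeasurableSpace.comap
      (fun ω : P.BitCoins => P.view Sᶜ (fun c => inp c (ω c).1) (fun c => (ω c).2))
      inferInstance := by
  refine P.crossSigma_le inp fun t ht a b h => ?_
  have hv := comap_measurable (m := (inferInstance : MeasurableSpace ((Sᶜ : Set V) → P.View)))
    (fun ω : P.BitCoins => P.view Sᶜ (fun c => inp c (ω c).1) (fun c => (ω c).2))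
  rcases h with ⟨-, hb⟩ | ⟨ha, -⟩
  · have hproj : Measurable fun q : (Sᶜ : Set V) → P.View => (q ⟨b, hb⟩).2.1 ⟨t, ht⟩ a := by
      fun_prop
    exact hproj.comp hv
  · have hproj : Measurable fun q : (Sᶜ : Set V) → P.View => (q ⟨a, ha⟩).2.2 ⟨t, ht⟩ b := by
      fun_prop
    exact hproj.comp hv

/-- Given the crossing messages of `N[a]`, the two values of the bit of `a` have likelihood ratio at
most `exp ε`. -/
theorem IsTGDP.bitCoins_real_le [Fintype V] [MeasurableSpace X] {P : Protocol.{u, v, w, z} V X}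
    {G : SimpleGraph V} {ε : ℝ} (hP : P.IsTGDP G ε 0) (inp : V → Bool → X) (a : V) (i : Bool)
    {E : Set P.BitCoins} (hE : MeasurableSet[P.crossSigma inp (closedNbhd G a) P.rounds] E) :
    P.bitCoins.real (E ∩ {ω | (ω a).1 = i}) ≤
      Real.exp ε * P.bitCoins.real (E ∩ {ω | (ω a).1 = !i}) := by
  classical
  have hbit : ∀ j, MeasurableSet {ω : P.BitCoins | (ω a).1 = j} := fun j =>
    (measurable_fst.comp (measurable_pi_apply a)) (measurableSet_singleton j)
  have hE₀ := P.crossSigma_le_pi inp _ _ E hE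
  obtain ⟨T, hT, rfl⟩ := P.crossSigma_le_comap_view inp (closedNbhd G a) E hE
  rw [P.bitCoins_real_eq_sum (hE₀.inter (hbit _)), P.bitCoins_real_eq_sum (hE₀.inter (hbit _)),
    Finset.mul_sum]
  -- Privacy is applied for each bit vector `s` with `s a = i`, paired with its flip at `a`.
  have hflip : Function.Involutive fun s : V → Bool => Function.update s a (!s a) := by
    intro s
    simp
  rw [← Equiv.sum_comp hflip.toPerm (fun s => Real.exp ε * _)]
  refine Finset.sum_le_sum fun s _ => ?_
  rw [mul_left_comm]
  refine mul_le_mul_of_nonneg_left ?_ (by positivity)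
  by_cases hs : s a = i
  · have hdp := hP a (fun c => inp c (s c)) (fun c => inp c (Function.update s a (!s a) c))
      (fun b hb => by simp [hb]) T hT
    simpa [hs] using hdp
  · have hempty : {r : ∀ a, P.Coin a | (fun a => (s a, r a)) ∈
        (fun ω : P.BitCoins => P.view (closedNbhd G a)ᶜ (fun c => inp c (ω c).1)
          (fun c => (ω c).2)) ⁻¹' T ∩ {ω | (ω a).1 = i}} = ∅ := by
      ext r; simp [hs]
    rw [hempty, measureReal_empty]
    positivity

theorem IsTGDP.ae_condExp_bit_mem_Icc [Fintype V] [MeasurableSpace X]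
    {P : Protocol.{u, v, w, z} V X} {G : SimpleGraph V} {ε ε₀ : ℝ} (hP : P.IsTGDP G ε 0)
    (hε : ε ≤ ε₀) (inp : V → Bool → X) (a : V) :
    ∀ᵐ ω ∂P.bitCoins, P.bitCoins[eventIndicator {ω | (ω a).1 = true} |
        P.crossSigma inp (closedNbhd G a) P.rounds] ω ∈
      Set.Icc (1 + Real.exp ε₀)⁻¹ (1 - (1 + Real.exp ε₀)⁻¹) := by
  have hbit : MeasurableSet {ω : P.BitCoins | (ω a).1 = true} :=
    (measurable_fst.comp (measurable_pi_apply a)) (measurableSet_singleton true)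
  refine ae_condExp_eventIndicator_mem_Icc (P.crossSigma_le_pi inp _ _) hbit fun E hE => ?_
  have h₁ := hP.bitCoins_real_le inp a true hE
  have h₂ := hP.bitCoins_real_le inp a false hE
  have hsum : P.bitCoins.real (E ∩ {ω | (ω a).1 = true}) +
      P.bitCoins.real (E ∩ {ω | (ω a).1 = false}) = P.bitCoins.real E := by
    rw [← measureReal_inter_add_sdiff (s := E) hbit]
    congr 2
    ext ω; simp
  have hexp : Real.exp ε ≤ Real.exp ε₀ := Real.exp_le_exp.2 hε
  have hpos : 0 < 1 + Real.exp ε₀ := by positivity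
  simp only [Bool.not_true, Bool.not_false] at h₁ h₂
  set t := P.bitCoins.real (E ∩ {ω | (ω a).1 = true})
  set f := P.bitCoins.real (E ∩ {ω | (ω a).1 = false})
  have ht : 0 ≤ t := measureReal_nonneg
  have hf : 0 ≤ f := measureReal_nonneg
  have h₁' : t ≤ Real.exp ε₀ * f := h₁.trans (mul_le_mul_of_nonneg_right hexp hf)
  have h₂' : f ≤ Real.exp ε₀ * t := h₂.trans (mul_le_mul_of_nonneg_right hexp ht)
  have key : ∀ {x y : ℝ}, y ≤ Real.exp ε₀ * x → (1 + Real.exp ε₀)⁻¹ * (x + y) ≤ x := by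
    intro x y h
    rw [inv_mul_le_iff₀ hpos]
    linarith
  rw [← hsum, sub_mul, one_mul]
  refine ⟨key h₂', ?_⟩
  have := key h₁'
  rw [add_comm f t] at this
  linarith

end Protocol

/-! ### Packings -/

theorem IsPacking.subset {V : Type u} {G : SimpleGraph V} {U U' : Finset V} (hU : IsPacking G U)
    (h : U' ⊆ U) : IsPacking G U' :=
  fun a ha b hb => hU a (h ha) b (h hb)

theorem exists_isPacking_card_eq_packingNumber {V : Type u} [Fintype V] (G : SimpleGraph V) :
    ∃ U : Finset V, IsPacking G U ∧ U.card = packingNumber G := by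
  refine Nat.sSup_mem (s := {k : ℕ | ∃ U : Finset V, IsPacking G U ∧ U.card = k})
    ⟨0, ∅, fun a ha => absurd ha (Finset.notMem_empty a), rfl⟩ ⟨Fintype.card V, ?_⟩
  rintro _ ⟨U, -, rfl⟩
  exact Finset.card_le_univ U

/-- A vertex `o` is in at most one of the closed neighbourhoods of a packing. -/
theorem IsPacking.card_le_card_filter_add_one {V : Type u} {G : SimpleGraph V} {U : Finset V}
    (hU : IsPacking G U) (o : V) [DecidablePred fun a => o ∉ closedNbhd G a] :
    U.card ≤ (U.filter fun a => o ∉ closedNbhd G a).card + 1 := by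
  rw [← Finset.card_filter_add_card_filter_not (s := U) fun a => o ∉ closedNbhd G a]
  refine Nat.add_le_add_left (Finset.card_le_one.2 fun a ha b hb => ?_) _
  simp only [Finset.mem_filter, not_not] at ha hb
  by_contra hab
  exact Set.disjoint_left.1 (hU a ha.1 b hb.1 hab) ha.2 hb.2

/-! ### The error on random inputs -/

namespace AggregationProtocol

variable {V : Type u} {Δ : ℕ}

/-- An outputter outside `S` computes its estimate from the randomness outside `S` and the crossing
messages. -/
theorem measurable_estimate (A : AggregationProtocol.{u, w, z} V Δ)
    (inp : V → Bool → Fin (Δ + 1)) {S : Set V} (hS : A.outputter ∉ S) :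
    Measurable[A.blockSigma Sᶜ ⊔ A.crossSigma inp S A.rounds] fun ω : A.BitCoins =>
      A.estimate (fun c => inp c (ω c).1) (fun c => (ω c).2) := by
  have hout : Measurable fun q : (Bool × A.Coin A.outputter) × (Fin A.rounds → V → A.Msg) =>
      A.output (inp A.outputter q.1.1) q.1.2 q.2 := by
    have : Measurable fun q : Bool × (A.Coin A.outputter × (Fin A.rounds → V → A.Msg)) =>
        A.output (inp A.outputter q.1) q.2.1 q.2.2 :=
      measurable_from_prod_countable_right fun i => A.measurable_output (inp A.outputter i)
    exact this.comp (measurable_fst.fst.prodMk (measurable_fst.snd.prodMk measurable_snd))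
  have hcomp : ∀ {m : MeasurableSpace A.BitCoins}, (Measurable[m] fun ω => ω A.outputter) →
      (∀ t < A.rounds, ∀ b, Measurable[m] fun ω => A.bitMessage inp ω t b A.outputter) →
      Measurable[m] fun ω => A.estimate (fun c => inp c (ω c).1) (fun c => (ω c).2) :=
    fun h₁ h₂ => hout.comp (h₁.prodMk (measurable_pi_lambda _ fun t =>
      measurable_pi_lambda _ fun b => h₂ t.1 t.2 b))
  exact hcomp ((A.measurable_coord (S := Sᶜ) hS).mono le_sup_left le_rfl)
    fun t ht b => A.measurable_bitMessage_outside inp ht (Or.inr hS)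

/-- The mean-square error is at least `|U| p² Δ²` with `p = 1 / (1 + exp ε₀)`, for a packing `U` whose
closed neighbourhoods do not contain the outputter. -/
theorem card_packing_le_mse [Fintype V] (A : AggregationProtocol.{u, w, z} V Δ)
    {G : SimpleGraph V} {ε ε₀ : ℝ} (hA : A.IsTGDP G ε 0) (hε : ε ≤ ε₀) {U : Finset V}
    (hU : IsPacking G U) (hout : ∀ a ∈ U, A.outputter ∉ closedNbhd G a) :
    ENNReal.ofReal ((U.card : ℝ) * (((1 + Real.exp ε₀)⁻¹) ^ 2 * (Δ : ℝ) ^ 2)) ≤ A.mse := by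
  classical
  rcases U.eq_empty_or_nonempty with rfl | ⟨a₀, ha₀⟩
  · simp
  set p : ℝ := (1 + Real.exp ε₀)⁻¹
  have hp : 0 ≤ p := by positivity
  set inp : V → Bool → Fin (Δ + 1) := fun a i => if a ∈ U ∧ i = true then Fin.last Δ else 0
    with hinp
  set μ := A.bitCoins
  set B : V → Set A.BitCoins := fun a => {ω | (ω a).1 = true} with hB
  set mc : V → MeasurableSpace A.BitCoins := fun a =>
    A.crossSigma inp (closedNbhd G a) A.rounds with hmc
  set m : V → MeasurableSpace A.BitCoins := fun a =>
    A.blockSigma (closedNbhd G a)ᶜ ⊔ mc a with hm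
  have hle : ∀ a, m a ≤ MeasurableSpace.pi := fun a =>
    sup_le (A.blockSigma_le _) (A.crossSigma_le_pi inp _ _)
  set g : V → A.BitCoins → ℝ := fun a => μ[eventIndicator (B a) | mc a] with hg
  set D : V → A.BitCoins → ℝ := fun a => eventIndicator (B a) - g a with hDdef
  set f : A.BitCoins → ℝ := fun ω => A.estimate (fun c => inp c (ω c).1) (fun c => (ω c).2)
    with hf
  have hself : ∀ a, a ∈ closedNbhd G a := fun a => Set.mem_insert a _
  have hBblock : ∀ {S : Set V} {a : V}, a ∈ S → MeasurableSet[A.blockSigma S] (B a) :=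
    fun ha => (measurable_fst.comp (A.measurable_coord ha)) (measurableSet_singleton true)
  have hB₀ : ∀ a, MeasurableSet (B a) := fun a => A.blockSigma_le _ _ (hBblock (hself a))
  have hgIcc : ∀ a, ∀ᵐ ω ∂μ, g a ω ∈ Set.Icc p (1 - p) := fun a =>
    hA.ae_condExp_bit_mem_Icc hε inp a
  -- For `b ≠ a`, the boundary of `N[b]` is crossed only by messages with an endpoint in `N[b]`, which
  -- is outside `N[a]`.
  have hgm : ∀ a ∈ U, ∀ b ∈ U, StronglyMeasurable[m a] (g b) := by
    intro a ha b hb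
    refine stronglyMeasurable_condExp.mono ?_
    rcases eq_or_ne b a with rfl | hba
    · exact le_sup_right
    · refine A.crossSigma_le inp fun t ht c d hcd => ?_
      refine A.measurable_bitMessage_outside inp ht ?_
      have hdisj := Set.disjoint_left.1 (hU b hb a ha hba)
      exact hcd.imp (fun h => hdisj h.1) (fun h => hdisj h.2)
  have hfm : ∀ a ∈ U, StronglyMeasurable[m a] f := fun a ha =>
    (A.measurable_estimate inp (hout a ha)).stronglyMeasurable
  have hf₀ : Measurable f := (hfm a₀ ha₀).measurable.mono (hle a₀) le_rfl
  have hDL : ∀ a, MemLp (D a) 2 μ := by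
    intro a
    refine MemLp.sub ?_ ?_
    · exact MemLp.of_bound (integrable_eventIndicator (hB₀ a)).aestronglyMeasurable 1
        (Filter.Eventually.of_forall fun ω => by
          by_cases h : ω ∈ B a <;> simp [eventIndicator, h])
    · refine MemLp.of_bound integrable_condExp.aestronglyMeasurable 1 ?_
      filter_upwards [hgIcc a] with ω hω
      rw [Real.norm_eq_abs, abs_le]
      exact ⟨by linarith [hω.1], by linarith [hω.2]⟩
  have hDp : ∀ a, ∀ᵐ ω ∂μ, p ≤ |D a ω| := by
    intro a
    filter_upwards [hgIcc a] with ω hω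
    by_cases h : ω ∈ B a
    · refine le_trans ?_ (le_abs_self _)
      simp only [hDdef, Pi.sub_apply, eventIndicator, Set.indicator_of_mem h]
      linarith [hω.2]
    · refine le_trans ?_ (neg_le_abs _)
      simp only [hDdef, Pi.sub_apply, eventIndicator, Set.indicator_of_notMem h]
      linarith [hω.1]
  have hDm : ∀ a ∈ U, ∀ b ∈ U, b ≠ a → StronglyMeasurable[m a] (D b) := by
    intro a ha b hb hba
    refine StronglyMeasurable.sub ?_ (hgm a ha b hb)
    have hmem : b ∈ (closedNbhd G a)ᶜ := Set.disjoint_left.1 (hU b hb a ha hba) (hself b)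
    exact stronglyMeasurable_const.indicator (le_sup_left (b := mc a) _ (hBblock hmem))
  -- Conditional independence: the randomness outside `N[a]` does not improve the guess `g a`.
  have hD0 : ∀ a ∈ U, μ[D a | m a] =ᵐ[μ] 0 := by
    intro a ha
    have h₁ := A.screenedOff_crossSigma inp (closedNbhd G a) A.rounds (B a) (hBblock (hself a))
    have h₂ : μ[g a | m a] = g a :=
      condExp_of_stronglyMeasurable (hle a) (hgm a ha a ha) integrable_condExp
    have h₃ := condExp_sub (μ := μ) (integrable_eventIndicator (hB₀ a))
      (integrable_condExp (f := eventIndicator (B a)) (m := mc a)) (m a)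
    filter_upwards [h₁, h₃] with ω e₁ e₃
    rw [e₃, Pi.sub_apply, h₂]
    exact sub_eq_zero.2 e₁
  -- The error `W` of the estimate is rewritten below as `R - Δ * ∑ D a`.
  set W : A.BitCoins → ℝ := fun ω => f ω - Δ * ∑ a ∈ U, eventIndicator (B a) ω with hW
  have hWm : Measurable W := by
    refine hf₀.sub (Measurable.const_mul (Finset.measurable_fun_sum U fun a _ => ?_) _)
    exact measurable_const.indicator (hB₀ a)
  have hsum : ∀ ω : A.BitCoins,
      ∑ a, ((inp a (ω a).1 : ℕ) : ℝ) = Δ * ∑ a ∈ U, eventIndicator (B a) ω := by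
    intro ω
    rw [Finset.mul_sum, ← Finset.sum_subset (Finset.subset_univ U)]
    · refine Finset.sum_congr rfl fun a ha => ?_
      by_cases h : (ω a).1 = true <;> simp [hinp, ha, h, eventIndicator, hB]
    · intro a _ ha
      simp [hinp, ha]
  have hmse : ∫⁻ ω, ENNReal.ofReal (W ω ^ 2) ∂μ ≤ A.mse := by
    refine A.lintegral_bitCoins_le (by fun_prop) fun s => ?_
    refine le_trans (le_of_eq ?_) (le_iSup _ fun a => inp a (s a))
    refine lintegral_congr fun r => ?_
    rw [hW]
    simp only [← hsum]
    rfl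
  rcases eq_or_ne (∫⁻ ω, ENNReal.ofReal (W ω ^ 2) ∂μ) ⊤ with htop | htop
  · exact le_top.trans (htop ▸ hmse)
  have hWi : Integrable (fun ω => W ω ^ 2) μ :=
    (lintegral_ofReal_ne_top_iff_integrable (hWm.pow_const 2).aestronglyMeasurable
      (Filter.Eventually.of_forall fun ω => sq_nonneg _)).1 htop
  have hWL : MemLp W 2 μ := (memLp_two_iff_integrable_sq hWm.aestronglyMeasurable).2 hWi
  set R : A.BitCoins → ℝ := fun ω => f ω - Δ * ∑ a ∈ U, g a ω with hR
  have hRW : ∀ ω, R ω - Δ * ∑ a ∈ U, D a ω = W ω := by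
    intro ω
    simp only [hR, hW, hDdef, Pi.sub_apply, Finset.sum_sub_distrib]
    ring
  have hRL : MemLp R 2 μ := by
    have : R = fun ω => W ω + Δ * ∑ a ∈ U, D a ω := by
      funext ω
      rw [← hRW]
      ring
    rw [this]
    exact hWL.add ((memLp_finsetSum U fun a _ => hDL a).const_mul _)
  have hRm : ∀ a ∈ U, StronglyMeasurable[m a] R := fun a ha =>
    (hfm a ha).sub ((Finset.stronglyMeasurable_fun_sum U fun b hb => hgm a ha b hb).const_mul _)
  have hmain := card_mul_le_integral_sub_sum_sq (d := (Δ : ℝ)) U (fun a _ => hle a) hp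
    (fun a _ => hDL a) (fun a _ => hDp a) hDm hD0 hRL hRm
  simp_rw [hRW] at hmain
  refine le_trans (ENNReal.ofReal_le_ofReal hmain) ?_
  rw [ofReal_integral_eq_lintegral_ofReal hWi (Filter.Eventually.of_forall fun ω => sq_nonneg _)]
  exact hmse

/-! ### Two datasets and a differentially private estimate -/

theorem measurable_estimate_coins (A : AggregationProtocol.{u, w, z} V Δ) (x : V → Fin (Δ + 1)) :
    Measurable (A.estimate x) := by
  have h := (A.measurable_estimate (fun a _ => x a) (Set.notMem_empty _)).mono
    (sup_le (A.blockSigma_le _) (A.crossSigma_le_pi _ _ _)) le_rfl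
  exact h.comp (A.measurable_withBits fun _ => true)

theorem lintegral_sq_le_mse [Fintype V] (A : AggregationProtocol.{u, w, z} V Δ)
    (x : V → Fin (Δ + 1)) :
    ∫⁻ r, ENNReal.ofReal ((A.estimate x r - ∑ a, ((x a : ℕ) : ℝ)) ^ 2) ∂A.coins ≤ A.mse :=
  le_iSup (fun x : V → Fin (Δ + 1) =>
    ∫⁻ r, ENNReal.ofReal ((A.estimate x r - ∑ a, ((x a : ℕ) : ℝ)) ^ 2) ∂A.coins) x

/-- Markov's inequality for the squared error: `d` is a lower bound for the squared error on the event
that the estimate is in `T`. -/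
theorem ofReal_mul_le_mse [Fintype V] (A : AggregationProtocol.{u, w, z} V Δ)
    (x : V → Fin (Δ + 1)) {d : ℝ} {T : Set ℝ} (hT : MeasurableSet T)
    (h : ∀ y ∈ T, d ≤ (y - ∑ a, ((x a : ℕ) : ℝ)) ^ 2) (hd : 0 ≤ d) :
    ENNReal.ofReal (d * A.coins.real {r | A.estimate x r ∈ T}) ≤ A.mse := by
  have hm : MeasurableSet {r | A.estimate x r ∈ T} := A.measurable_estimate_coins x hT
  refine le_trans ?_ (A.lintegral_sq_le_mse x)
  rw [ENNReal.ofReal_mul hd, ofReal_measureReal, ← lintegral_indicator_const hm]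
  refine lintegral_mono fun r => ?_
  by_cases hr : r ∈ {r | A.estimate x r ∈ T}
  · rw [Set.indicator_of_mem hr]
    exact ENNReal.ofReal_le_ofReal (h _ hr)
  · rw [Set.indicator_of_notMem hr]
    exact zero_le

/-- Either of two events makes the error at least `Δ / 2`: an estimate of at least `Δ / 2` when the sum
is `0`, and an estimate below `Δ / 2` when the sum is `Δ`. Privacy of the estimate forces one of them
to have probability at least `1 / (1 + exp ε₀)`. -/
theorem EstimateIsDP.sq_div_four_le_mse [Fintype V] {A : AggregationProtocol.{u, w, z} V Δ}
    {ε ε₀ : ℝ} (hA : A.EstimateIsDP ε 0) (hε : ε ≤ ε₀) :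
    ENNReal.ofReal ((1 + Real.exp ε₀)⁻¹ * ((Δ : ℝ) ^ 2 / 4)) ≤ A.mse := by
  classical
  set o := A.outputter
  set x₀ : V → Fin (Δ + 1) := fun _ => 0
  set x₁ : V → Fin (Δ + 1) := Function.update x₀ o (Fin.last Δ)
  have hs₀ : ∑ a, ((x₀ a : ℕ) : ℝ) = 0 := by simp [x₀]
  have hs₁ : ∑ a, ((x₁ a : ℕ) : ℝ) = Δ := by
    rw [Finset.sum_eq_single o]
    · simp [x₁]
    · intro b _ hb
      simp [x₁, x₀, hb]
    · simp
  have hd : (0 : ℝ) ≤ (Δ : ℝ) ^ 2 / 4 := by positivity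
  have hΔ : (0 : ℝ) ≤ Δ := Nat.cast_nonneg Δ
  have h₀ := A.ofReal_mul_le_mse x₀ (T := Set.Ici ((Δ : ℝ) / 2)) measurableSet_Ici
    (d := (Δ : ℝ) ^ 2 / 4) (fun y hy => by
      have hy' : (Δ : ℝ) / 2 ≤ y := hy
      rw [hs₀]; nlinarith) hd
  have h₁ := A.ofReal_mul_le_mse x₁ (T := (Set.Ici ((Δ : ℝ) / 2))ᶜ) measurableSet_Ici.compl
    (d := (Δ : ℝ) ^ 2 / 4) (fun y hy => by
      have hy' : y < (Δ : ℝ) / 2 := not_le.1 hy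
      rw [hs₁]; nlinarith) hd
  have hdp := hA o x₁ x₀ (fun b hb => by simp [x₁, hb]) (Set.Ici ((Δ : ℝ) / 2)) measurableSet_Ici
  have hcompl := probReal_compl_eq_one_sub (μ := A.coins)
    (A.measurable_estimate_coins x₁ (measurableSet_Ici (a := (Δ : ℝ) / 2)))
  have hexp : Real.exp ε ≤ Real.exp ε₀ := Real.exp_le_exp.2 hε
  have hpos : 0 < 1 + Real.exp ε₀ := by positivity
  set q₀ := A.coins.real {r | A.estimate x₀ r ∈ Set.Ici ((Δ : ℝ) / 2)}
  have hq₀ : 0 ≤ q₀ := measureReal_nonneg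
  change A.coins.real {r | A.estimate x₁ r ∈ (Set.Ici ((Δ : ℝ) / 2))ᶜ} =
    1 - A.coins.real {r | A.estimate x₁ r ∈ Set.Ici ((Δ : ℝ) / 2)} at hcompl
  rw [hcompl] at h₁
  have hdp' : A.coins.real {r | A.estimate x₁ r ∈ Set.Ici ((Δ : ℝ) / 2)} ≤
      Real.exp ε₀ * q₀ := by
    have := mul_le_mul_of_nonneg_right hexp hq₀
    linarith
  rw [mul_comm]
  rcases le_total ((1 + Real.exp ε₀)⁻¹) q₀ with hq | hq
  · exact (ENNReal.ofReal_le_ofReal (mul_le_mul_of_nonneg_left hq hd)).trans h₀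
  · refine (ENNReal.ofReal_le_ofReal (mul_le_mul_of_nonneg_left ?_ hd)).trans h₁
    have h₂ := mul_le_mul_of_nonneg_left hq (Real.exp_pos ε₀).le
    have h₃ : (1 + Real.exp ε₀)⁻¹ + Real.exp ε₀ * (1 + Real.exp ε₀)⁻¹ = 1 := by
      field_simp
    linarith

end AggregationProtocol

end TrustGraph

theorem mainTheorem2 (ε₀ : ℝ) :
    ∃ c : ℝ, 0 < c ∧
      ∀ (V : Type u) [Fintype V] (G : SimpleGraph V) (Δ : ℕ) (ε : ℝ)
        (A : TrustGraph.AggregationProtocol.{u, w, z} V Δ),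
        ε ≤ ε₀ →
        A.toProtocol.IsTGDP G ε 0 →
        ((∃ a : V, a ∉ TrustGraph.closedNbhd G A.outputter) ∨ A.EstimateIsDP ε 0) →
        ENNReal.ofReal (c * (Δ : ℝ) ^ 2 * (TrustGraph.packingNumber G : ℝ)) ≤ A.mse := by
  classical
  have hp : 0 < (1 + Real.exp ε₀)⁻¹ := by positivity
  have hp₁ : (1 + Real.exp ε₀)⁻¹ ≤ 1 := inv_le_one_of_one_le₀ (by linarith [Real.exp_pos ε₀])
  refine ⟨(1 + Real.exp ε₀)⁻¹ ^ 2 / 4, by positivity, fun V _ G Δ ε A hε hT hout => ?_⟩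
  obtain ⟨U, hU, hcard⟩ := TrustGraph.exists_isPacking_card_eq_packingNumber G
  rw [← hcard]
  set p := (1 + Real.exp ε₀)⁻¹
  have hpΔ : 0 ≤ p ^ 2 * (Δ : ℝ) ^ 2 := by positivity
  rcases le_or_gt 2 U.card with h2 | h1
  -- Of `k ≥ 2` members, at least `k - 1 ≥ k / 2` are left without the block of the outputter.
  · set U' := U.filter fun a => A.outputter ∉ TrustGraph.closedNbhd G a
    have hU' : (U.card : ℝ) ≤ U'.card + 1 := by
      exact_mod_cast hU.card_le_card_filter_add_one A.outputter
    have h2' : (2 : ℝ) ≤ U.card := by exact_mod_cast h2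
    refine le_trans (ENNReal.ofReal_le_ofReal ?_)
      (A.card_packing_le_mse hT hε (hU.subset (Finset.filter_subset _ _))
        fun a ha => (Finset.mem_filter.1 ha).2)
    nlinarith
  · have h1' : (U.card : ℝ) ≤ 1 := by exact_mod_cast Nat.le_of_lt_succ h1
    rcases hout with ⟨a, ha⟩ | hdp
    · have hpack : TrustGraph.IsPacking G {a} := by
        intro b hb c hc hbc
        rw [Finset.mem_singleton] at hb hc
        exact absurd (hb.trans hc.symm) hbc
      refine le_trans (ENNReal.ofReal_le_ofReal ?_)
        (A.card_packing_le_mse hT hε hpack fun b hb => ?_)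
      · simp only [Finset.card_singleton]
        nlinarith
      · rw [Finset.mem_singleton.1 hb]
        rintro (h | h)
        · exact ha (Or.inl h.symm)
        · exact ha (Or.inr h.symm)
    · refine le_trans (ENNReal.ofReal_le_ofReal ?_) (hdp.sq_div_four_le_mse hε)
      have hpp : p ^ 2 ≤ p := by nlinarith
      calc p ^ 2 / 4 * (Δ : ℝ) ^ 2 * U.card ≤ p ^ 2 / 4 * (Δ : ℝ) ^ 2 * 1 := by gcongr
        _ = p ^ 2 * ((Δ : ℝ) ^ 2 / 4) := by ring
        _ ≤ p * ((Δ : ℝ) ^ 2 / 4) := by gcongr
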